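/- Let $m,n\ge 1$, let $A\in\mathbb R^{m\times n}$ and let $\beta\in\mathbb R^n$ be non-zero. For $\alpha\in\mathbb R^m$ let $G(\alpha)=(A,\,-A+\alpha\beta^T)$ be the bimatrix game with these payoff matrices, and let $\Gamma=\{G(\alpha)\mid\alpha\in\mathbb R^m\}\subset\mathbb R^{m\times n}\times\mathbb R^{m\times n}$. Let $\Delta_1\subset\mathbb R^m$ and $\Delta_2\subset\mathbb R^n$ be the simplices of mixed strategies; $(x,y)\in\Delta_1\times\Delta_2$ is a Nash equilibrium of $(A,B)$ if $x^TAy\ge x'^TAy$ for all $x'\in\Delta_1$ and $x^TBy\ge x^TBy'$ for all $y'\in\Delta_2$. Put $$E_\Gamma=\{(\alpha,x,y)\in\mathbb R^m\times\Delta_1\times\Delta_2\mid (x,y)\text{ is a Nash equilibrium of }G(\alpha)\}.$$ Let $A_i$ denote the $i$-th row and $A^j$ the $j$-th column of $A$, and consider the polyhedra $$P=\Big\{(y,\pi_1)\in\mathbb R^{n+1}\ \Big|\ A_iy-\pi_1\le 0\ (1\le i\le m),\ y_j\ge 0\ (1\le j\le n),\ \sum_{j=1}^n y_j=1\Big\},$$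 $$Q'=\Big\{(x,\lambda,\pi_2)\in\mathbb R^{m+2}\ \Big|\ x_i\ge 0\ (1\le i\le m),\ -x^TA^j+\beta_j\lambda-\pi_2\le 0\ (1\le j\le n),\ \sum_{i=1}^m x_i=1\Big\}.$$ Assume that $P$ and $Q'$ are non-degenerate in the following sense: at every point of $P$ at most $n$ of the $m+n$ listed inequalities are tight, with exactly $n$ tight if and only if the point is a vertex of $P$; and at every point of $Q'$ at most $m+1$ of the $m+n$ listed inequalities are tight, with exactly $m+1$ tight if and only if the point is a vertex of $Q'$. Then $\alpha\mapsto G(\alpha)$ is a homeomorphism $\mathbb R^m\to\Gamma$, and $E_\Gamma$ is homeomorphic to $\Gamma$. More precisely, after identifying $\Gamma$ with $\mathbb R^m$ in this way, the map $f:E_\Gamma\to\Gamma$, $$f(\alpha,x,y)=(\beta^Ty+\alpha^Tx,\ \alpha_2-\alpha_1,\ \dots,\ \alpha_m-\alpha_1),$$ is a homeomorphism. -/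

import Mathlib

open scoped Matrix

namespace RankOneGame

/-- `(x, y)` is a Nash equilibrium strategy profile of the bimatrix game `G = (A, B)` with `m × n`
payoff matrices: `x` and `y` are mixed strategies, and no player gains by a unilateral deviation. -/
def IsNash {m n : ℕ} (G : Matrix (Fin m) (Fin n) ℝ × Matrix (Fin m) (Fin n) ℝ)
    (x : Fin m → ℝ) (y : Fin n → ℝ) : Prop :=
  x ∈ stdSimplex ℝ (Fin m) ∧ y ∈ stdSimplex ℝ (Fin n) ∧
    (∀ x' ∈ stdSimplex ℝ (Fin m), x' ⬝ᵥ (G.1 *ᵥ y) ≤ x ⬝ᵥ (G.1 *ᵥ y)) ∧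
    (∀ y' ∈ stdSimplex ℝ (Fin n), x ⬝ᵥ (G.2 *ᵥ y') ≤ x ⬝ᵥ (G.2 *ᵥ y))

/-- The game `G(α) = (A, C + α βᵀ)`. -/
def game {m n : ℕ} (A C : Matrix (Fin m) (Fin n) ℝ) (β : Fin n → ℝ) (α : Fin m → ℝ) :
    Matrix (Fin m) (Fin n) ℝ × Matrix (Fin m) (Fin n) ℝ :=
  (A, C + Matrix.vecMulVec α β)

/-- The game space `Γ = {(A, C + α βᵀ) | α ∈ ℝᵐ}`. -/
def gameSpace {m n : ℕ} (A C : Matrix (Fin m) (Fin n) ℝ) (β : Fin n → ℝ) :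
    Set (Matrix (Fin m) (Fin n) ℝ × Matrix (Fin m) (Fin n) ℝ) :=
  Set.range (game A C β)

/-- The Nash equilibrium correspondence `E_Γ`: the triples `(α, x, y)` such that `(x, y)` is a Nash
equilibrium strategy profile of `G(α)`. -/
def nashCorrespondence {m n : ℕ} (A C : Matrix (Fin m) (Fin n) ℝ) (β : Fin n → ℝ) :
    Set ((Fin m → ℝ) × (Fin m → ℝ) × (Fin n → ℝ)) :=
  {p | IsNash (game A C β p.1) p.2.1 p.2.2}

/-- The best response polytope `P` of the row player, with points `(y, π₁)`. -/
def polyP {m n : ℕ} (A : Matrix (Fin m) (Fin n) ℝ) : Set ((Fin n → ℝ) × ℝ) :=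
  {v | (∀ i, (A *ᵥ v.1) i - v.2 ≤ 0) ∧ (∀ j, 0 ≤ v.1 j) ∧ ∑ j, v.1 j = 1}

/-- The polytope `Q'`, with points `(x, lam, π₂)`. -/
def polyQ {m n : ℕ} (C : Matrix (Fin m) (Fin n) ℝ) (β : Fin n → ℝ) :
    Set ((Fin m → ℝ) × ℝ × ℝ) :=
  {w | (∀ i, 0 ≤ w.1 i) ∧ (∀ j, (w.1 ᵥ* C) j + β j * w.2.1 - w.2.2 ≤ 0) ∧ ∑ i, w.1 i = 1}

/-- The label of `v = (y, π₁)`: the set of inequalities of `P` that are tight at `v`. The index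
`Sum.inl i` stands for `i`, and `Sum.inr j` for `m + j`. -/
def labelP {m n : ℕ} (A : Matrix (Fin m) (Fin n) ℝ) (v : (Fin n → ℝ) × ℝ) :
    Set (Fin m ⊕ Fin n) :=
  {k | Sum.elim (fun i => (A *ᵥ v.1) i - v.2 = 0) (fun j => v.1 j = 0) k}

/-- The label of `w = (x, lam, π₂)`: the set of inequalities of `Q'` that are tight at `w`. -/
def labelQ {m n : ℕ} (C : Matrix (Fin m) (Fin n) ℝ) (β : Fin n → ℝ)
    (w : (Fin m → ℝ) × ℝ × ℝ) : Set (Fin m ⊕ Fin n) :=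
  {k | Sum.elim (fun i => w.1 i = 0) (fun j => (w.1 ᵥ* C) j + β j * w.2.1 - w.2.2 = 0) k}

/-- `P`, of dimension `n`, is non-degenerate: at most `n` inequalities are tight at each point, and
exactly `n` are tight precisely at the vertices. -/
def NondegenerateP {m n : ℕ} (A : Matrix (Fin m) (Fin n) ℝ) : Prop :=
  ∀ v ∈ polyP A, (labelP A v).ncard ≤ n ∧
    ((labelP A v).ncard = n ↔ v ∈ Set.extremePoints ℝ (polyP A))

/-- `Q'`, of dimension `m + 1`, is non-degenerate: at most `m + 1` inequalities are tight at each
point, and exactly `m + 1` are tight precisely at the vertices. -/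
def NondegenerateQ {m n : ℕ} (C : Matrix (Fin m) (Fin n) ℝ) (β : Fin n → ℝ) : Prop :=
  ∀ w ∈ polyQ C β, (labelQ C β w).ncard ≤ m + 1 ∧
    ((labelQ C β w).ncard = m + 1 ↔ w ∈ Set.extremePoints ℝ (polyQ C β))

/-- The map `f(α, x, y) = (βᵀ y + αᵀ x, α₂ - α₁, …, α_m - α₁)`; the first coordinate has index
`0 : Fin m`. -/
def encode {m n : ℕ} [NeZero m] (β : Fin n → ℝ)
    (p : (Fin m → ℝ) × (Fin m → ℝ) × (Fin n → ℝ)) : Fin m → ℝ :=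
  fun i => if i = 0 then β ⬝ᵥ p.2.2 + p.1 ⬝ᵥ p.2.1 else p.1 i - p.1 0

end RankOneGame

/-! A pair (v, w) in P × Q' has gap π₁ + π₂ - lam βᵀy. This is a sum of nonnegative products of
slacks, because the xᵀAy terms of the two payoffs cancel, and it vanishes exactly when the pair is
complementary. Equilibria of G(α) are complementary pairs with lam = αᵀx (`isNash_iff`), and the
first coordinate of f is s = lam + βᵀy.

Injectivity (`eq_of_gap_eq_zero`): for two complementary pairs with equal s, the two cross gaps sum
to -(lam - lam')², so lam = lam' and both cross gaps vanish. The midpoints are then complementary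
too, so together they have at least m + n tight constraints. Nondegeneracy makes one midpoint a
vertex, which identifies that component, and the independence of its tight constraints identifies
the other.

Surjectivity (`exists_mem_polyP_mem_polyQ`): given s, a saddle point of xᵀAy + (βᵀy - s)²/2 supplies
the pair.

Since α is a continuous function of f, x and y, compactness of the simplices makes f a closed map,
hence a homeomorphism. -/

/-! ### Tight constraints at vertices of polyhedra -/

section Polyhedron

open Filter Topology

variable {V K : Type*} [AddCommGroup V] [Module ℝ V] [Finite K]

/-- A direction annihilated by all constraints that are tight at an extreme point of a polyhedron
vanishes. -/
theorem eq_zero_of_mem_extremePoints_polyhedron (φ : K → V →ₗ[ℝ] ℝ) (ψ : V →ₗ[ℝ] ℝ) {v u : V}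
    (hv : v ∈ Set.extremePoints ℝ {v | (∀ k, φ k v ≤ 0) ∧ ψ v = 1})
    (hφ : ∀ k, φ k v = 0 → φ k u = 0) (hψ : ψ u = 0) : u = 0 := by
  obtain ⟨⟨hv1, hv2⟩, hext⟩ := hv
  -- Slack constraints survive small moves along `u`, and tight ones do not change; there are
  -- finitely many. So `v` is the midpoint of a segment in the polyhedron.
  have key : ∀ᶠ ε : ℝ in 𝓝 0, ∀ k, φ k (v + ε • u) ≤ 0 := by
    rw [eventually_all]
    intro k
    rcases (hv1 k).lt_or_eq with h | h
    · have hc : Tendsto (fun ε : ℝ => φ k v + ε * φ k u) (𝓝 0) (𝓝 (φ k v + 0 * φ k u)) :=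
        Continuous.tendsto (by fun_prop) 0
      rw [zero_mul, add_zero] at hc
      filter_upwards [hc.eventually_lt_const h] with ε hε
      simpa using hε.le
    · filter_upwards with ε
      simp [h, hφ k h]
  have key' : ∀ᶠ ε : ℝ in 𝓝 0, ∀ k, φ k (v + (-ε) • u) ≤ 0 := by
    have : Tendsto (fun ε : ℝ => -ε) (𝓝 0) (𝓝 0) := by simpa using (continuous_neg.tendsto (0 : ℝ))
    exact this.eventually key
  obtain ⟨ε, ⟨h1, h2⟩, hε⟩ := (((key.and key').filter_mono nhdsWithin_le_nhds).and
    (self_mem_nhdsWithin : Set.Ioi (0 : ℝ) ∈ 𝓝[>] 0)).exists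
  have hmem : v ∈ openSegment ℝ (v + ε • u) (v + (-ε) • u) :=
    ⟨1 / 2, 1 / 2, by norm_num, by norm_num, by norm_num, by module⟩
  have := hext (x₁ := v + ε • u) ⟨h1, by simp [hv2, hψ]⟩ (x₂ := v + (-ε) • u)
    ⟨h2, by simp [hv2, hψ]⟩ hmem
  have h3 : ε • u = 0 := by simpa using this
  exact (smul_eq_zero.1 h3).resolve_left (ne_of_gt hε)

/-- At an extreme point of a polyhedron with as many tight constraints as its dimension, the tight
constraints can be given arbitrary values. -/
theorem exists_of_mem_extremePoints_polyhedron [FiniteDimensional ℝ V] (φ : K → V →ₗ[ℝ] ℝ)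
    (ψ : V →ₗ[ℝ] ℝ) {v : V} (hv : v ∈ Set.extremePoints ℝ {v | (∀ k, φ k v ≤ 0) ∧ ψ v = 1})
    (hcard : Module.finrank ℝ V = {k | φ k v = 0}.ncard + 1) (t : K → ℝ) :
    ∃ u, (∀ k, φ k v = 0 → φ k u = t k) ∧ ψ u = 0 := by
  have := Fintype.ofFinite {k | φ k v = 0}
  let Ψ : V →ₗ[ℝ] ({k | φ k v = 0} → ℝ) × ℝ := (LinearMap.pi fun k => φ k.1).prod ψ
  have hinj : Function.Injective Ψ := by
    rw [← LinearMap.ker_eq_bot, LinearMap.ker_eq_bot']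
    intro u hu
    obtain ⟨h1, h2⟩ := Prod.ext_iff.1 hu
    exact eq_zero_of_mem_extremePoints_polyhedron φ ψ hv (fun k hk => congrFun h1 ⟨k, hk⟩) h2
  have hrank : Module.finrank ℝ V = Module.finrank ℝ (({k | φ k v = 0} → ℝ) × ℝ) := by
    rw [hcard, Module.finrank_prod, Module.finrank_self, Module.finrank_fintype_fun_eq_card,
      ← Nat.card_eq_fintype_card, Nat.card_coe_set_eq]
  obtain ⟨u, hu⟩ := (LinearMap.injective_iff_surjective_of_finrank_eq_finrank hrank).1 hinj
    (fun k => t k.1, 0)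
  obtain ⟨h1, h2⟩ := Prod.ext_iff.1 hu
  exact ⟨u, fun k hk => congrFun h1 ⟨k, hk⟩, h2⟩

end Polyhedron

theorem eq_zero_of_sum_mul_self_eq_zero {ι : Type*} [Fintype ι] {d : ι → ℝ}
    (h : ∑ i, d i * d i = 0) : d = 0 :=
  dotProduct_self_eq_zero.1 h

namespace RankOneGame

variable {m n : ℕ} {A : Matrix (Fin m) (Fin n) ℝ} {β : Fin n → ℝ}
  {v v' : (Fin n → ℝ) × ℝ} {w w' : (Fin m → ℝ) × ℝ × ℝ}

/-- The tight constraints at a nondegenerate vertex of `P` can be given arbitrary values. -/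
theorem NondegenerateP.exists_direction (hP : NondegenerateP A) (hv : v ∈ polyP A)
    (hcard : (labelP A v).ncard = n) (t : Fin m → ℝ) :
    ∃ (u : Fin n → ℝ) (p : ℝ), (∀ i, Sum.inl i ∈ labelP A v → (A *ᵥ u) i - p = t i) ∧
      (∀ j, Sum.inr j ∈ labelP A v → u j = 0) ∧ ∑ j, u j = 0 := by
  let φ : Fin m ⊕ Fin n → ((Fin n → ℝ) × ℝ) →ₗ[ℝ] ℝ := Sum.elim
    (fun i => LinearMap.proj i ∘ₗ A.mulVecLin ∘ₗ LinearMap.fst ℝ _ _ - LinearMap.snd ℝ _ _)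
    (fun j => -(LinearMap.proj j ∘ₗ LinearMap.fst ℝ _ _))
  let ψ : ((Fin n → ℝ) × ℝ) →ₗ[ℝ] ℝ := (∑ j, LinearMap.proj j) ∘ₗ LinearMap.fst ℝ _ _
  have hl (i : Fin m) (v) : φ (Sum.inl i) v = (A *ᵥ v.1) i - v.2 := by simp [φ]
  have hr (j : Fin n) (v) : φ (Sum.inr j) v = -v.1 j := by simp [φ]
  have hψ (v) : ψ v = ∑ j, v.1 j := by simp [ψ]
  have hpoly : polyP A = {v | (∀ k, φ k v ≤ 0) ∧ ψ v = 1} := by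
    ext v
    simp [polyP, Sum.forall, hl, hr, hψ, and_assoc]
  have hlabel : labelP A v = {k | φ k v = 0} := by
    ext (i | j) <;> simp [labelP, hl, hr]
  have hext := ((hP v hv).2.1 hcard)
  rw [hpoly] at hext
  -- The `n` tight inequalities and the equation `ψ = 1` match the dimension `n + 1` of the space of
  -- `(y, π₁)`.
  obtain ⟨u, hu, hu'⟩ := exists_of_mem_extremePoints_polyhedron φ ψ hext
    (by rw [← hlabel, hcard]; simp) (Sum.elim t 0)
  refine ⟨u.1, u.2, fun i hi => ?_, fun j hj => ?_, by rw [← hψ, hu']⟩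
  · rw [hlabel] at hi
    simpa [hl] using hu _ hi
  · rw [hlabel] at hj
    simpa [hr] using hu _ hj

/-- The tight constraints at a nondegenerate vertex of `Q'` can be given arbitrary values. -/
theorem NondegenerateQ.exists_direction {C : Matrix (Fin m) (Fin n) ℝ} (hQ : NondegenerateQ C β)
    (hw : w ∈ polyQ C β) (hcard : (labelQ C β w).ncard = m + 1) (t : Fin n → ℝ) :
    ∃ (u : Fin m → ℝ) (μ p : ℝ), (∀ i, Sum.inl i ∈ labelQ C β w → u i = 0) ∧
      (∀ j, Sum.inr j ∈ labelQ C β w → (u ᵥ* C) j + β j * μ - p = t j) ∧ ∑ i, u i = 0 := by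
  let φ : Fin m ⊕ Fin n → ((Fin m → ℝ) × ℝ × ℝ) →ₗ[ℝ] ℝ := Sum.elim
    (fun i => -(LinearMap.proj i ∘ₗ LinearMap.fst ℝ _ _))
    (fun j => LinearMap.proj j ∘ₗ C.vecMulLinear ∘ₗ LinearMap.fst ℝ _ _ +
      β j • (LinearMap.fst ℝ _ _ ∘ₗ LinearMap.snd ℝ _ _) -
      LinearMap.snd ℝ _ _ ∘ₗ LinearMap.snd ℝ _ _)
  let ψ : ((Fin m → ℝ) × ℝ × ℝ) →ₗ[ℝ] ℝ := (∑ i, LinearMap.proj i) ∘ₗ LinearMap.fst ℝ _ _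
  have hl (i : Fin m) (w) : φ (Sum.inl i) w = -w.1 i := by simp [φ]
  have hr (j : Fin n) (w) : φ (Sum.inr j) w = (w.1 ᵥ* C) j + β j * w.2.1 - w.2.2 := by simp [φ]
  have hψ (w) : ψ w = ∑ i, w.1 i := by simp [ψ]
  have hpoly : polyQ C β = {w | (∀ k, φ k w ≤ 0) ∧ ψ w = 1} := by
    ext w
    simp [polyQ, Sum.forall, hl, hr, hψ, and_assoc]
  have hlabel : labelQ C β w = {k | φ k w = 0} := by
    ext (i | j) <;> simp [labelQ, hl, hr]
  have hext := ((hQ w hw).2.1 hcard)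
  rw [hpoly] at hext
  obtain ⟨u, hu, hu'⟩ := exists_of_mem_extremePoints_polyhedron φ ψ hext
    (by rw [← hlabel, hcard]; simp [add_assoc]) (Sum.elim 0 t)
  refine ⟨u.1, u.2.1, u.2.2, fun i hi => ?_, fun j hj => ?_, by rw [← hψ, hu']⟩
  · rw [hlabel] at hi
    simpa [hl] using hu _ hi
  · rw [hlabel] at hj
    simpa [hr] using hu _ hj

/-! ### Complementarity and uniqueness -/

/-- The complementarity gap of a point `(y, π₁)` of `P` and a point `(x, lam, π₂)` of `Q'`. -/
def gap (β : Fin n → ℝ) (v : (Fin n → ℝ) × ℝ) (w : (Fin m → ℝ) × ℝ × ℝ) : ℝ :=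
  v.2 + w.2.2 - w.2.1 * (β ⬝ᵥ v.1)

theorem gap_eq_sum (hv : v ∈ polyP A) (hw : w ∈ polyQ (-A) β) :
    gap β v w = ∑ i, w.1 i * (v.2 - (A *ᵥ v.1) i) +
      ∑ j, v.1 j * (w.2.2 - ((w.1 ᵥ* -A) j + β j * w.2.1)) := by
  have h1 : ∑ i, w.1 i * (v.2 - (A *ᵥ v.1) i) = v.2 - w.1 ⬝ᵥ (A *ᵥ v.1) := by
    simp only [mul_sub, Finset.sum_sub_distrib, ← Finset.sum_mul, hw.2.2, one_mul, dotProduct]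
  have h2 : ∑ j, v.1 j * (w.2.2 - ((w.1 ᵥ* -A) j + β j * w.2.1)) =
      w.2.2 - (w.1 ᵥ* -A) ⬝ᵥ v.1 - w.2.1 * (β ⬝ᵥ v.1) := by
    simp only [mul_sub, Finset.sum_sub_distrib, ← Finset.sum_mul, hv.2.2, one_mul,
      dotProduct, Finset.mul_sum, ← sub_sub]
    congr 1
    · simp only [mul_comm]
    · exact Finset.sum_congr rfl fun j _ => by ring
  rw [h1, h2, ← Matrix.dotProduct_mulVec, Matrix.neg_mulVec, dotProduct_neg, gap]
  ring

theorem gap_nonneg (hv : v ∈ polyP A) (hw : w ∈ polyQ (-A) β) : 0 ≤ gap β v w := by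
  rw [gap_eq_sum hv hw]
  exact add_nonneg
    (Finset.sum_nonneg fun i _ => mul_nonneg (hw.1 i) (by linarith [hv.1 i]))
    (Finset.sum_nonneg fun j _ => mul_nonneg (hv.2.1 j) (by linarith [hw.2.1 j]))

theorem mem_label_or_mem_label (hv : v ∈ polyP A) (hw : w ∈ polyQ (-A) β)
    (h : gap β v w = 0) (k : Fin m ⊕ Fin n) : k ∈ labelP A v ∨ k ∈ labelQ (-A) β w := by
  have h1 (i : Fin m) : 0 ≤ w.1 i * (v.2 - (A *ᵥ v.1) i) :=
    mul_nonneg (hw.1 i) (by linarith [hv.1 i])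
  have h2 (j : Fin n) : 0 ≤ v.1 j * (w.2.2 - ((w.1 ᵥ* -A) j + β j * w.2.1)) :=
    mul_nonneg (hv.2.1 j) (by linarith [hw.2.1 j])
  rw [gap_eq_sum hv hw, add_eq_zero_iff_of_nonneg (Finset.sum_nonneg fun i _ => h1 i)
    (Finset.sum_nonneg fun j _ => h2 j), Finset.sum_eq_zero_iff_of_nonneg fun i _ => h1 i,
    Finset.sum_eq_zero_iff_of_nonneg fun j _ => h2 j] at h
  rcases k with i | j
  · rcases mul_eq_zero.1 (h.1 i (Finset.mem_univ i)) with h | h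
    · exact Or.inr h
    · exact Or.inl (show (A *ᵥ v.1) i - v.2 = 0 by linarith)
  · rcases mul_eq_zero.1 (h.2 j (Finset.mem_univ j)) with h | h
    · exact Or.inl h
    · exact Or.inr (show (w.1 ᵥ* -A) j + β j * w.2.1 - w.2.2 = 0 by linarith)

theorem card_le_ncard_label_add (hv : v ∈ polyP A) (hw : w ∈ polyQ (-A) β)
    (h : gap β v w = 0) : m + n ≤ (labelP A v).ncard + (labelQ (-A) β w).ncard := by
  have huniv : labelP A v ∪ labelQ (-A) β w = Set.univ :=
    Set.eq_univ_of_forall (mem_label_or_mem_label hv hw h)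
  have := Set.ncard_union_le (labelP A v) (labelQ (-A) β w)
  rw [huniv, Set.ncard_univ] at this
  simpa using this

theorem midpoint_mem_polyP (hv : v ∈ polyP A) (hv' : v' ∈ polyP A) :
    (1 / 2 : ℝ) • v + (1 / 2 : ℝ) • v' ∈ polyP A := by
  refine ⟨fun i => ?_, fun j => ?_, ?_⟩
  · simp [Matrix.mulVec_add, Matrix.mulVec_smul]
    linarith [hv.1 i, hv'.1 i]
  · simp
    linarith [hv.2.1 j, hv'.2.1 j]
  · simp [Finset.sum_add_distrib, ← Finset.mul_sum, hv.2.2, hv'.2.2]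
    norm_num

theorem midpoint_mem_polyQ {C : Matrix (Fin m) (Fin n) ℝ} (hw : w ∈ polyQ C β)
    (hw' : w' ∈ polyQ C β) : (1 / 2 : ℝ) • w + (1 / 2 : ℝ) • w' ∈ polyQ C β := by
  refine ⟨fun i => ?_, fun j => ?_, ?_⟩
  · simp
    linarith [hw.1 i, hw'.1 i]
  · simp [Matrix.add_vecMul, Matrix.smul_vecMul]
    linarith [hw.2.1 j, hw'.2.1 j]
  · simp [Finset.sum_add_distrib, ← Finset.mul_sum, hw.2.2, hw'.2.2]
    norm_num

theorem eq_of_midpoint_mem_extremePoints {E : Type*} [AddCommGroup E] [Module ℝ E]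
    {S : Set E} {a b : E} (ha : a ∈ S) (hb : b ∈ S)
    (h : (1 / 2 : ℝ) • a + (1 / 2 : ℝ) • b ∈ Set.extremePoints ℝ S) : a = b := by
  have hseg : (1 / 2 : ℝ) • a + (1 / 2 : ℝ) • b ∈ openSegment ℝ a b :=
    ⟨1 / 2, 1 / 2, by norm_num, by norm_num, by norm_num, rfl⟩
  have hseg' : (1 / 2 : ℝ) • a + (1 / 2 : ℝ) • b ∈ openSegment ℝ b a := by
    rwa [openSegment_symm]
  exact (h.2 ha hb hseg).trans (h.2 hb ha hseg').symm

/-- A point of `P` with `n` tight constraints has at most one complementary `x` for each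
parameter. -/
theorem NondegenerateP.fst_eq (hP : NondegenerateP A) (hv : v ∈ polyP A)
    (hcard : (labelP A v).ncard = n) (hw : w ∈ polyQ (-A) β) (hw' : w' ∈ polyQ (-A) β)
    (h : gap β v w = 0) (h' : gap β v w' = 0) (hlam : w.2.1 = w'.2.1) : w.1 = w'.1 := by
  set d := w.1 - w'.1 with hd
  obtain ⟨u, p, hu1, hu2, hu3⟩ := hP.exists_direction hv hcard d
  rw [← sub_eq_zero, ← hd]
  have hdsum : ∑ i, d i = 0 := by simp [hd, hw.2.2, hw'.2.2]
  apply eq_zero_of_sum_mul_self_eq_zero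
  -- Where row `i` is not tight, complementarity forces `d i = 0`. Then `p` drops out since `d` sums
  -- to zero, and `d ᵥ* A` is constant on the support of `u`, which also sums to zero.
  calc ∑ i, d i * d i = ∑ i, d i * ((A *ᵥ u) i - p) := by
        refine Finset.sum_congr rfl fun i _ => ?_
        by_cases hi : Sum.inl i ∈ labelP A v
        · rw [hu1 i hi]
        · have h1 : w.1 i = 0 := (mem_label_or_mem_label hv hw h _).resolve_left hi
          have h2 : w'.1 i = 0 := (mem_label_or_mem_label hv hw' h' _).resolve_left hi
          simp [hd, h1, h2]
    _ = (d ᵥ* A) ⬝ᵥ u := by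
        rw [← Matrix.dotProduct_mulVec]
        simp only [mul_sub, Finset.sum_sub_distrib, ← Finset.sum_mul, hdsum, zero_mul, sub_zero,
          dotProduct]
    _ = ∑ j, (w'.2.2 - w.2.2) * u j := by
        refine Finset.sum_congr rfl fun j _ => ?_
        by_cases hj : Sum.inr j ∈ labelP A v
        · simp [hu2 j hj]
        · have h1 : (w.1 ᵥ* -A) j + β j * w.2.1 - w.2.2 = 0 :=
            (mem_label_or_mem_label hv hw h _).resolve_left hj
          have h2 : (w'.1 ᵥ* -A) j + β j * w'.2.1 - w'.2.2 = 0 :=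
            (mem_label_or_mem_label hv hw' h' _).resolve_left hj
          rw [hlam] at h1
          simp only [Matrix.vecMul_neg, Pi.neg_apply] at h1 h2
          have : (d ᵥ* A) j = w'.2.2 - w.2.2 := by
            simp only [hd, Matrix.sub_vecMul, Pi.sub_apply]
            linarith
          rw [this]
    _ = 0 := by rw [← Finset.mul_sum, hu3, mul_zero]

/-- A point of `Q'` with `m + 1` tight constraints has at most one complementary `y` with a given
value of `βᵀ y`. -/
theorem NondegenerateQ.fst_eq (hQ : NondegenerateQ (-A) β) (hw : w ∈ polyQ (-A) β)
    (hcard : (labelQ (-A) β w).ncard = m + 1) (hv : v ∈ polyP A) (hv' : v' ∈ polyP A)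
    (h : gap β v w = 0) (h' : gap β v' w = 0) (hβ : β ⬝ᵥ v.1 = β ⬝ᵥ v'.1) : v.1 = v'.1 := by
  set d := v.1 - v'.1 with hd
  obtain ⟨u, μ, p, hu1, hu2, hu3⟩ := hQ.exists_direction hw hcard d
  rw [← sub_eq_zero, ← hd]
  have hdsum : ∑ j, d j = 0 := by simp [hd, hv.2.2, hv'.2.2]
  have hdβ : β ⬝ᵥ d = 0 := by rw [hd, dotProduct_sub, hβ, sub_self]
  apply eq_zero_of_sum_mul_self_eq_zero
  calc ∑ j, d j * d j = ∑ j, ((u ᵥ* -A) j + β j * μ - p) * d j := by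
        refine Finset.sum_congr rfl fun j _ => ?_
        by_cases hj : Sum.inr j ∈ labelQ (-A) β w
        · rw [hu2 j hj]
        · have h1 : v.1 j = 0 := (mem_label_or_mem_label hv hw h _).resolve_right hj
          have h2 : v'.1 j = 0 := (mem_label_or_mem_label hv' hw h' _).resolve_right hj
          simp [hd, h1, h2]
    _ = (u ᵥ* -A) ⬝ᵥ d + μ * (β ⬝ᵥ d) - p * ∑ j, d j := by
        simp only [dotProduct, Finset.mul_sum, ← Finset.sum_add_distrib, ← Finset.sum_sub_distrib]
        exact Finset.sum_congr rfl fun j _ => by ring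
    _ = u ⬝ᵥ (-A *ᵥ d) := by rw [hdβ, hdsum, Matrix.dotProduct_mulVec]; ring
    _ = ∑ i, u i * (v'.2 - v.2) := by
        refine Finset.sum_congr rfl fun i _ => ?_
        by_cases hi : Sum.inl i ∈ labelQ (-A) β w
        · simp [hu1 i hi]
        · have h1 : (A *ᵥ v.1) i - v.2 = 0 :=
            (mem_label_or_mem_label hv hw h _).resolve_right hi
          have h2 : (A *ᵥ v'.1) i - v'.2 = 0 :=
            (mem_label_or_mem_label hv' hw h' _).resolve_right hi
          have : (-A *ᵥ d) i = v'.2 - v.2 := by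
            simp only [hd, Matrix.neg_mulVec, Matrix.mulVec_sub, Pi.sub_apply, Pi.neg_apply]
            linarith
          rw [this]
    _ = 0 := by rw [← Finset.sum_mul, hu3, zero_mul]

/-- Complementary pairs are determined by the value of `lam + βᵀ y`. -/
theorem eq_of_gap_eq_zero (hP : NondegenerateP A) (hQ : NondegenerateQ (-A) β)
    (hv : v ∈ polyP A) (hv' : v' ∈ polyP A) (hw : w ∈ polyQ (-A) β) (hw' : w' ∈ polyQ (-A) β)
    (h : gap β v w = 0) (h' : gap β v' w' = 0)
    (hs : w.2.1 + β ⬝ᵥ v.1 = w'.2.1 + β ⬝ᵥ v'.1) :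
    v.1 = v'.1 ∧ w.1 = w'.1 ∧ w.2.1 = w'.2.1 := by
  have hvw' := gap_nonneg hv hw'
  have hv'w := gap_nonneg hv' hw
  have hlam : w.2.1 = w'.2.1 := by
    -- The sum of the cross gaps is (lam - lam')(βᵀy - βᵀy'), which equals -(lam - lam')² by `hs`.
    have hb : β ⬝ᵥ v.1 = w'.2.1 + β ⬝ᵥ v'.1 - w.2.1 := by linarith
    have hsq : (w.2.1 - w'.2.1) ^ 2 ≤ 0 := by
      simp only [gap, hb] at h h' hvw' hv'w
      linarith
    exact sub_eq_zero.1 (pow_eq_zero_iff two_ne_zero |>.1 (le_antisymm hsq (sq_nonneg _)))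
  have hb : β ⬝ᵥ v.1 = β ⬝ᵥ v'.1 := by linarith
  have g1 : gap β v w' = 0 := by
    simp only [gap] at h h' hvw' hv'w ⊢
    rw [hlam, hb] at h
    rw [hb] at hvw' ⊢
    rw [hlam] at hv'w
    linarith
  have g2 : gap β v' w = 0 := by
    simp only [gap] at h h' hvw' hv'w ⊢
    rw [hlam, hb] at h
    rw [hb] at hvw'
    rw [hlam] at hv'w ⊢
    linarith
  have hvm := midpoint_mem_polyP hv hv'
  have hwm := midpoint_mem_polyQ hw hw'
  have gl {w : (Fin m → ℝ) × ℝ × ℝ} (a : gap β v w = 0) (b : gap β v' w = 0) :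
      gap β ((1 / 2 : ℝ) • v + (1 / 2 : ℝ) • v') w = 0 := by
    simp only [gap, Prod.fst_add, Prod.snd_add, Prod.smul_fst, Prod.smul_snd, dotProduct_add,
      dotProduct_smul, smul_eq_mul] at a b ⊢
    linarith
  have gr {v : (Fin n → ℝ) × ℝ} (a : gap β v w = 0) (b : gap β v w' = 0) :
      gap β v ((1 / 2 : ℝ) • w + (1 / 2 : ℝ) • w') = 0 := by
    simp only [gap, Prod.fst_add, Prod.snd_add, Prod.smul_fst, Prod.smul_snd, smul_eq_mul]
      at a b ⊢
    linarith
  have hcard := card_le_ncard_label_add hvm hwm (gl (gr h g1) (gr g2 h'))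
  have hcP := (hP _ hvm).1
  have hcQ := (hQ _ hwm).1
  -- If fewer than `n` constraints are tight in P, the count `m + n` forces `m + 1` in Q'.
  rcases eq_or_lt_of_le hcP with hn | hn
  · exact ⟨congrArg Prod.fst
      (eq_of_midpoint_mem_extremePoints hv hv' ((hP _ hvm).2.1 hn)),
      hP.fst_eq hvm hn hw hw' (gl h g2) (gl g1 h') hlam, hlam⟩
  · have hm := le_antisymm hcQ (by omega)
    exact ⟨hQ.fst_eq hwm hm hv hv' (gr h g1) (gr g2 h') hb, congrArg Prod.fst
      (eq_of_midpoint_mem_extremePoints hw hw' ((hQ _ hwm).2.1 hm)), hlam⟩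

end RankOneGame

/-! ### Equilibria as complementary pairs -/

namespace RankOneGame

open Filter Topology

variable {m n : ℕ} {A : Matrix (Fin m) (Fin n) ℝ} {β : Fin n → ℝ}

theorem dotProduct_le_of_mem_stdSimplex {ι : Type*} [Fintype ι] {x f : ι → ℝ} {c : ℝ}
    (hx : x ∈ stdSimplex ℝ ι) (h : ∀ i, f i ≤ c) : x ⬝ᵥ f ≤ c :=
  calc x ⬝ᵥ f ≤ ∑ i, x i * c :=
        Finset.sum_le_sum fun i _ => mul_le_mul_of_nonneg_left (h i) (hx.1 i)
    _ = c := by rw [← Finset.sum_mul, hx.2, one_mul]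

theorem dotProduct_game_snd_mulVec (A : Matrix (Fin m) (Fin n) ℝ) (β : Fin n → ℝ)
    (α x : Fin m → ℝ) (y : Fin n → ℝ) :
    x ⬝ᵥ ((game A (-A) β α).2 *ᵥ y) = -(x ⬝ᵥ (A *ᵥ y)) + (α ⬝ᵥ x) * (β ⬝ᵥ y) := by
  rw [game, Matrix.add_mulVec, dotProduct_add, Matrix.neg_mulVec, dotProduct_neg,
    Matrix.vecMulVec_mulVec, dotProduct_smul, dotProduct_comm α x]
  simp

/-- Nash equilibria correspond to complementary pairs of points of `P` and `Q'`. -/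
theorem isNash_iff {α x : Fin m → ℝ} {y : Fin n → ℝ} :
    IsNash (game A (-A) β α) x y ↔ (y, x ⬝ᵥ (A *ᵥ y)) ∈ polyP A ∧
      (x, α ⬝ᵥ x, -(x ⬝ᵥ (A *ᵥ y)) + (α ⬝ᵥ x) * (β ⬝ᵥ y)) ∈ polyQ (-A) β := by
  simp only [IsNash, dotProduct_game_snd_mulVec]
  constructor
  · rintro ⟨hx, hy, h1, h2⟩
    refine ⟨⟨fun i => ?_, hy.1, hy.2⟩, hx.1, fun j => ?_, hx.2⟩
    · have := h1 _ (single_mem_stdSimplex ℝ i)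
      simp only [game, single_one_dotProduct] at this
      exact sub_nonpos.2 this
    · have := h2 _ (single_mem_stdSimplex ℝ j)
      rw [Matrix.dotProduct_mulVec, dotProduct_single_one, dotProduct_single_one] at this
      simp only [Matrix.vecMul_neg, Pi.neg_apply]
      linarith
  · rintro ⟨⟨h1, hy1, hy2⟩, hx1, h2, hx2⟩
    refine ⟨⟨hx1, hx2⟩, ⟨hy1, hy2⟩, fun x' hx' => ?_, fun y' hy' => ?_⟩
    · exact dotProduct_le_of_mem_stdSimplex hx' fun i => sub_nonpos.1 (h1 i)
    · have := dotProduct_le_of_mem_stdSimplex hy' fun j => sub_nonpos.1 (h2 j)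
      refine le_of_eq_of_le ?_ this
      have h3 : (fun j => (x ᵥ* -A) j + β j * (α ⬝ᵥ x)) = x ᵥ* -A + (α ⬝ᵥ x) • β := by
        ext j
        simp [mul_comm]
      simp only [h3]
      rw [dotProduct_add, dotProduct_smul, Matrix.vecMul_neg, dotProduct_neg,
        dotProduct_comm y' (x ᵥ* A), ← Matrix.dotProduct_mulVec, dotProduct_comm y' β, smul_eq_mul]

/-- First-order optimality condition: for small `t` the quadratic term cannot offset a negative
slope `a`. -/
theorem nonneg_of_forall_mul_add_sq_mul_nonneg {a c : ℝ} (hc : 0 ≤ c)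
    (h : ∀ t : ℝ, 0 < t → t ≤ 1 → 0 ≤ t * a + t ^ 2 * c) : 0 ≤ a := by
  by_contra! ha
  have hcpos : 0 < c + -a := by linarith
  have ht : 0 < -a / (2 * (c + -a)) := by
    have : 0 < -a := by linarith
    positivity
  have ht1 : -a / (2 * (c + -a)) ≤ 1 := by
    rw [div_le_one (by positivity)]
    linarith
  have hs : -a / (2 * (c + -a)) * (2 * (c + -a)) = -a := div_mul_cancel₀ _ (by positivity)
  have := h _ ht ht1
  set t := -a / (2 * (c + -a))
  have h1 : 0 ≤ a + t * c := by
    have : 0 ≤ t * (a + t * c) := by linarith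
    exact nonneg_of_mul_nonneg_right this ht
  nlinarith

/-- A saddle point of `xᵀ A y + (βᵀ y - s)² / 2` yields an optimal pair for the parameter
`lam = s - βᵀ y`. -/
theorem exists_mem_polyP_mem_polyQ [NeZero m] [NeZero n] (A : Matrix (Fin m) (Fin n) ℝ)
    (β : Fin n → ℝ) (s : ℝ) :
    ∃ (x : Fin m → ℝ) (y : Fin n → ℝ) (lam : ℝ), lam + β ⬝ᵥ y = s ∧
      (y, x ⬝ᵥ (A *ᵥ y)) ∈ polyP A ∧
      (x, lam, -(x ⬝ᵥ (A *ᵥ y)) + lam * (β ⬝ᵥ y)) ∈ polyQ (-A) β := by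
  have hcont : Continuous fun p : (Fin n → ℝ) × (Fin m → ℝ) =>
      p.2 ⬝ᵥ (A *ᵥ p.1) + (β ⬝ᵥ p.1 - s) ^ 2 / 2 := by fun_prop
  have hconv (x : Fin m → ℝ) : ConvexOn ℝ (stdSimplex ℝ (Fin n))
      fun y => x ⬝ᵥ (A *ᵥ y) + (β ⬝ᵥ y - s) ^ 2 / 2 := by
    refine ⟨convex_stdSimplex ℝ _, fun y _ z _ a b ha hb hab => ?_⟩
    simp only [Matrix.mulVec_add, Matrix.mulVec_smul, dotProduct_add, dotProduct_smul, smul_eq_mul]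
    obtain rfl : b = 1 - a := by linarith
    nlinarith [mul_nonneg (mul_nonneg ha hb) (sq_nonneg (β ⬝ᵥ y - β ⬝ᵥ z))]
  have hconc (y : Fin n → ℝ) : ConcaveOn ℝ (stdSimplex ℝ (Fin m))
      fun x => x ⬝ᵥ (A *ᵥ y) + (β ⬝ᵥ y - s) ^ 2 / 2 := by
    refine ⟨convex_stdSimplex ℝ _, fun x _ z _ a b ha hb hab => le_of_eq ?_⟩
    simp only [add_dotProduct, smul_dotProduct, smul_eq_mul]
    obtain rfl : b = 1 - a := by linarith
    ring
  -- Here `y` minimizes and `x` maximizes. The quadratic term does not involve `x`, so `x` is a best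
  -- response to `y` in `A`.
  obtain ⟨y, hy, x, hx, hsaddle⟩ := Sion.exists_isSaddlePointOn
    (f := fun (y : Fin n → ℝ) (x : Fin m → ℝ) => x ⬝ᵥ (A *ᵥ y) + (β ⬝ᵥ y - s) ^ 2 / 2)
    ⟨_, single_mem_stdSimplex ℝ (0 : Fin n)⟩ (convex_stdSimplex ℝ _) (isCompact_stdSimplex ℝ _)
    (fun x _ => (hcont.comp (Continuous.prodMk_left x)).lowerSemicontinuous.lowerSemicontinuousOn _)
    (fun x _ => (hconv x).quasiconvexOn) (convex_stdSimplex ℝ _)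
    ⟨_, single_mem_stdSimplex ℝ (0 : Fin m)⟩ (isCompact_stdSimplex ℝ _)
    (fun y _ =>
      (hcont.comp (Continuous.prodMk_right y)).upperSemicontinuous.upperSemicontinuousOn _)
    (fun y _ => (hconc y).quasiconcaveOn)
  refine ⟨x, y, s - β ⬝ᵥ y, by ring, ⟨fun i => ?_, hy.1, hy.2⟩, hx.1, fun j => ?_, hx.2⟩
  · have := hsaddle y hy _ (single_mem_stdSimplex ℝ i)
    simp only [single_one_dotProduct] at this
    simp only
    linarith
  · set b := β ⬝ᵥ y with hb
    -- The right-hand side is the derivative of the objective at `y` towards the `j`-th pure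
    -- strategy; with `lam = s - b` this is the `j`-th inequality of Q'.
    have key : 0 ≤ (x ᵥ* A) j - x ⬝ᵥ (A *ᵥ y) + (b - s) * (β j - b) := by
      refine nonneg_of_forall_mul_add_sq_mul_nonneg (c := (β j - b) ^ 2 / 2) (by positivity)
        fun t ht ht1 => ?_
      have hmem : (1 - t) • y + t • Pi.single j 1 ∈ stdSimplex ℝ (Fin n) :=
        convex_stdSimplex ℝ _ hy (single_mem_stdSimplex ℝ j) (by linarith) ht.le (by ring)
      have := hsaddle _ hmem x hx
      simp only [Matrix.mulVec_add, Matrix.mulVec_smul, dotProduct_add, dotProduct_smul,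
        smul_eq_mul, ← hb] at this
      rw [Matrix.dotProduct_mulVec x A (Pi.single j 1), dotProduct_single_one,
        dotProduct_single_one] at this
      linarith
    simp only [Matrix.vecMul_neg, Pi.neg_apply]
    linarith

/-! ### Recovering α, and the homeomorphism -/

theorem encode_zero [NeZero m] (β : Fin n → ℝ) (p : (Fin m → ℝ) × (Fin m → ℝ) × (Fin n → ℝ)) :
    encode β p 0 = β ⬝ᵥ p.2.2 + p.1 ⬝ᵥ p.2.1 :=
  if_pos rfl

theorem encode_of_ne [NeZero m] (β : Fin n → ℝ) (p : (Fin m → ℝ) × (Fin m → ℝ) × (Fin n → ℝ))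
    {i : Fin m} (hi : i ≠ 0) : encode β p i = p.1 i - p.1 0 :=
  if_neg hi

/-- The payoff parameter `α` of a point of the Nash correspondence, recovered from its image `a`
under `encode` and from the strategies `x` and `y`. -/
def decode [NeZero m] (β : Fin n → ℝ) (a x : Fin m → ℝ) (y : Fin n → ℝ) : Fin m → ℝ :=
  fun i => (if i = 0 then 0 else a i) + (a 0 - β ⬝ᵥ y - (fun k => if k = 0 then 0 else a k) ⬝ᵥ x)

theorem continuous_decode [NeZero m] (β : Fin n → ℝ) :
    Continuous fun p : (Fin m → ℝ) × (Fin m → ℝ) × (Fin n → ℝ) => decode β p.1 p.2.1 p.2.2 := by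
  refine continuous_pi fun i => ?_
  have h (k : Fin m) : Continuous fun p : (Fin m → ℝ) × (Fin m → ℝ) × (Fin n → ℝ) =>
      if k = 0 then 0 else p.1 k := by
    split_ifs <;> fun_prop
  simp only [decode, dotProduct]
  fun_prop

theorem continuous_encode [NeZero m] (β : Fin n → ℝ) :
    Continuous (encode β : (Fin m → ℝ) × (Fin m → ℝ) × (Fin n → ℝ) → Fin m → ℝ) := by
  refine continuous_pi fun i => ?_
  by_cases hi : i = 0
  · subst hi
    simp only [encode_zero]
    fun_prop
  · simp only [encode_of_ne β _ hi]
    fun_prop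

/-- The additive constant in `decode` is chosen to make this hold: it contributes itself because `x`
sums to one. -/
theorem decode_dotProduct [NeZero m] (β : Fin n → ℝ) (a : Fin m → ℝ) {x : Fin m → ℝ}
    (y : Fin n → ℝ) (hx : ∑ i, x i = 1) : decode β a x y ⬝ᵥ x = a 0 - β ⬝ᵥ y := by
  simp only [decode, dotProduct, add_mul, Finset.sum_add_distrib, ← Finset.mul_sum, hx]
  ring

theorem encode_decode [NeZero m] (β : Fin n → ℝ) (a : Fin m → ℝ) {x : Fin m → ℝ}
    (y : Fin n → ℝ) (hx : ∑ i, x i = 1) : encode β (decode β a x y, x, y) = a := by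
  ext i
  by_cases hi : i = 0
  · subst hi
    rw [encode_zero, decode_dotProduct β a y hx]
    ring
  · rw [encode_of_ne β _ hi]
    simp [decode, hi]

theorem decode_encode [NeZero m] (β : Fin n → ℝ) (α : Fin m → ℝ) {x : Fin m → ℝ}
    (y : Fin n → ℝ) (hx : ∑ i, x i = 1) : decode β (encode β (α, x, y)) x y = α := by
  have h (i : Fin m) : (if i = 0 then 0 else encode β (α, x, y) i) = α i - α 0 := by
    by_cases hi : i = 0
    · simp [hi]
    · simp [hi, encode_of_ne β _ hi]
  have h' : ∑ i, (α i - α 0) * x i = α ⬝ᵥ x - α 0 := by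
    simp only [sub_mul, Finset.sum_sub_distrib, ← Finset.mul_sum, hx, mul_one, dotProduct]
  ext i
  simp only [decode, h, encode_zero]
  simp only [dotProduct, h'] at h' ⊢
  ring

theorem isClosed_polyP (A : Matrix (Fin m) (Fin n) ℝ) : IsClosed (polyP A) := by
  refine IsClosed.and (isClosed_le (f := fun v : (Fin n → ℝ) × ℝ => fun i => (A *ᵥ v.1) i - v.2)
    (g := 0) ?_ continuous_const) (IsClosed.and
    (isClosed_le (f := 0) (g := fun v : (Fin n → ℝ) × ℝ => v.1) continuous_const ?_)
    (isClosed_eq ?_ continuous_const))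
  all_goals fun_prop

theorem isClosed_polyQ (C : Matrix (Fin m) (Fin n) ℝ) (β : Fin n → ℝ) :
    IsClosed (polyQ C β) := by
  refine IsClosed.and
    (isClosed_le (f := 0) (g := fun w : (Fin m → ℝ) × ℝ × ℝ => w.1) continuous_const ?_)
    (IsClosed.and (isClosed_le
      (f := fun w : (Fin m → ℝ) × ℝ × ℝ => fun j => (w.1 ᵥ* C) j + β j * w.2.1 - w.2.2)
      (g := 0) ?_ continuous_const) (isClosed_eq ?_ continuous_const))
  all_goals fun_prop

theorem isClosed_nashCorrespondence (A : Matrix (Fin m) (Fin n) ℝ) (β : Fin n → ℝ) :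
    IsClosed (nashCorrespondence A (-A) β) := by
  have h1 : Continuous fun p : (Fin m → ℝ) × (Fin m → ℝ) × (Fin n → ℝ) =>
      (p.2.2, p.2.1 ⬝ᵥ (A *ᵥ p.2.2)) := by fun_prop
  have h2 : Continuous fun p : (Fin m → ℝ) × (Fin m → ℝ) × (Fin n → ℝ) =>
      (p.2.1, p.1 ⬝ᵥ p.2.1, -(p.2.1 ⬝ᵥ (A *ᵥ p.2.2)) + (p.1 ⬝ᵥ p.2.1) * (β ⬝ᵥ p.2.2)) := by
    fun_prop
  convert ((isClosed_polyP A).preimage h1).inter ((isClosed_polyQ (-A) β).preimage h2) using 1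
  exact Set.ext fun p => isNash_iff

/-- The image of a closed set is the projection, along the compact product of simplices, of its
closed preimage under `g`. -/
theorem isClosedMap_encode [NeZero m] (A : Matrix (Fin m) (Fin n) ℝ) (β : Fin n → ℝ) :
    IsClosedMap fun p : nashCorrespondence A (-A) β => encode β p.1 := by
  intro S hS
  obtain ⟨T, hT, rfl⟩ := isClosed_induced_iff.1 hS
  have : CompactSpace (stdSimplex ℝ (Fin m)) :=
    isCompact_iff_compactSpace.1 (isCompact_stdSimplex ℝ _)
  have : CompactSpace (stdSimplex ℝ (Fin n)) :=
    isCompact_iff_compactSpace.1 (isCompact_stdSimplex ℝ _)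
  let g : (Fin m → ℝ) × (stdSimplex ℝ (Fin m) × stdSimplex ℝ (Fin n)) →
      (Fin m → ℝ) × (Fin m → ℝ) × (Fin n → ℝ) :=
    fun q => (decode β q.1 q.2.1 q.2.2, (q.2.1 : Fin m → ℝ), (q.2.2 : Fin n → ℝ))
  have hg : Continuous g := by
    have h1 : Continuous fun q : (Fin m → ℝ) × (stdSimplex ℝ (Fin m) × stdSimplex ℝ (Fin n)) =>
        (q.1, (q.2.1 : Fin m → ℝ), (q.2.2 : Fin n → ℝ)) := by fun_prop
    exact ((continuous_decode β).comp h1).prodMk (by fun_prop)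
  convert isClosedMap_fst_of_compactSpace _
    ((hT.inter (isClosed_nashCorrespondence A β)).preimage hg) using 1
  ext a
  constructor
  · rintro ⟨⟨⟨α, x, y⟩, hp⟩, hpT, rfl⟩
    have hgp : g (encode β (α, x, y), ⟨x, hp.1⟩, ⟨y, hp.2.1⟩) = (α, x, y) :=
      Prod.ext (decode_encode β α y hp.1.2) rfl
    refine ⟨(encode β (α, x, y), ⟨x, hp.1⟩, ⟨y, hp.2.1⟩), ?_, rfl⟩
    rw [Set.mem_preimage, hgp]
    exact ⟨hpT, hp⟩
  · rintro ⟨⟨a, x, y⟩, ⟨hqT, hq⟩, rfl⟩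
    exact ⟨⟨_, hq⟩, hqT, encode_decode β a _ x.2.2⟩

theorem injective_encode [NeZero m] (hP : NondegenerateP A) (hQ : NondegenerateQ (-A) β) :
    Function.Injective fun p : nashCorrespondence A (-A) β => encode β p.1 := by
  rintro ⟨⟨α, x, y⟩, hp⟩ ⟨⟨α', x', y'⟩, hp'⟩ h
  replace h : encode β (α, x, y) = encode β (α', x', y') := h
  have h1 := isNash_iff.1 hp
  have h2 := isNash_iff.1 hp'
  have h0 := congrFun h 0
  rw [encode_zero, encode_zero] at h0
  obtain ⟨hy, hx, -⟩ := eq_of_gap_eq_zero hP hQ h1.1 h2.1 h1.2 h2.2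
    (by simp only [gap]; ring) (by simp only [gap]; ring) (by simpa [add_comm] using h0)
  obtain rfl : y = y' := hy
  obtain rfl : x = x' := hx
  have hα := decode_encode β α y hp.1.2
  rw [h, decode_encode β α' y hp.1.2] at hα
  simp only [hα]

theorem surjective_encode [NeZero m] [NeZero n] (A : Matrix (Fin m) (Fin n) ℝ) (β : Fin n → ℝ) :
    Function.Surjective fun p : nashCorrespondence A (-A) β => encode β p.1 := by
  intro a
  obtain ⟨x, y, lam, hs, hy, hx⟩ := exists_mem_polyP_mem_polyQ A β (a 0)
  have hlam : decode β a x y ⬝ᵥ x = lam := by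
    rw [decode_dotProduct β a y hx.2.2]
    linarith
  refine ⟨⟨(decode β a x y, x, y), isNash_iff.2 ⟨hy, ?_⟩⟩, encode_decode β a y hx.2.2⟩
  rwa [hlam]

theorem isHomeomorph_encode [NeZero m] [NeZero n] (hP : NondegenerateP A)
    (hQ : NondegenerateQ (-A) β) :
    IsHomeomorph fun p : nashCorrespondence A (-A) β => encode β p.1 :=
  isHomeomorph_iff_continuous_isClosedMap_bijective.2
    ⟨(continuous_encode β).comp continuous_subtype_val, isClosedMap_encode A β,
      injective_encode hP hQ, surjective_encode A β⟩

/-- The parametrization `α ↦ G(α)` of the game space is a homeomorphism. -/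
theorem exists_homeomorph_gameSpace (A C : Matrix (Fin m) (Fin n) ℝ) (hβ : β ≠ 0) :
    ∃ G : (Fin m → ℝ) ≃ₜ gameSpace A C β, ∀ α, (G α : _ × _) = game A C β α := by
  obtain ⟨j, hj⟩ := Function.ne_iff.1 hβ
  have hcont : Continuous (game A C β) := by
    unfold game
    fun_prop
  -- One column with `β j ≠ 0` suffices to read off `α`.
  have hinv : Function.LeftInverse
      (fun G : Matrix (Fin m) (Fin n) ℝ × Matrix (Fin m) (Fin n) ℝ =>
        fun i => (G.2 i j - C i j) / β j) (game A C β) := by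
    intro α
    ext i
    simp only [game, Matrix.add_apply, Matrix.vecMulVec_apply, add_sub_cancel_left]
    exact mul_div_cancel_right₀ _ hj
  exact ⟨(hinv.isEmbedding (by fun_prop) hcont).toHomeomorph, fun α => rfl⟩

end RankOneGame

theorem mainTheorem1 {m n : ℕ} [NeZero m] (A : Matrix (Fin m) (Fin n) ℝ) (β : Fin n → ℝ)
    (hβ : β ≠ 0) (hP : RankOneGame.NondegenerateP A) (hQ : RankOneGame.NondegenerateQ (-A) β) :
    ∃ (G : (Fin m → ℝ) ≃ₜ RankOneGame.gameSpace A (-A) β)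
      (F : RankOneGame.nashCorrespondence A (-A) β ≃ₜ RankOneGame.gameSpace A (-A) β),
      (∀ α : Fin m → ℝ, (G α : Matrix (Fin m) (Fin n) ℝ × Matrix (Fin m) (Fin n) ℝ) =
        RankOneGame.game A (-A) β α) ∧
      ∀ p : RankOneGame.nashCorrespondence A (-A) β,
        F p = G (RankOneGame.encode β
          (p : (Fin m → ℝ) × (Fin m → ℝ) × (Fin n → ℝ))) := by
  -- A nonzero `β` has an index, so `n ≥ 1`.
  obtain ⟨j, -⟩ := Function.ne_iff.1 hβ
  have : NeZero n := ⟨(Fin.pos j).ne'⟩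
  obtain ⟨G, hG⟩ := RankOneGame.exists_homeomorph_gameSpace A (-A) hβ
  exact ⟨G, ((RankOneGame.isHomeomorph_encode hP hQ).homeomorph _).trans G, hG, fun p => rfl⟩
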